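/- Let $G=(V,E)$ be a finite, simple, connected, undirected graph with $n$ vertices and at least one edge. For $w\in\mathbb{R}^E$ let $\mathcal{L}(w)=\sum_{ab\in E}w_{ab}(e_a-e_b)(e_a-e_b)^T$ be the weighted Laplacian, with eigenvalues $\lambda_1(w)\le\lambda_2(w)\le\dots\le\lambda_n(w)$ counted with multiplicity, and let $$\Delta_E=\Big\{w\in\mathbb{R}^E:\ w\ge 0,\ \sum_{e\in E}w_e=|E|\Big\}.$$ For $1\le k\le n-1$ put $S_k(w)=\sum_{i=n-k+1}^{n}\lambda_i(w)$ and $s_k(w)=\sum_{i=2}^{k+1}\lambda_i(w)$. Let $\mathbb{1}\in\Delta_E$ be the all-ones vector. The graph $G$ is called totally conformally rigid if for every $k\in\{1,\dots,n-1\}$ and all $w,w'\in\Delta_E$, $$s_k(w)\le s_k(\mathbb{1})\le S_k(\mathbb{1})\le S_k(w').$$ Theorem. If $G$ is totally conformally rigid, then $w=\mathbb{1}$ maximizes the weighted spanning-tree count $$\tau(G,w)=\sum_{T}\prod_{e\in T}w_e,$$ the sum being over all spanning trees $T$ of $G$, over all $w\in\Delta_E$; that is, $\tau(G,w)\le\tau(G,\mathbb{1})$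 for every $w\in\Delta_E$. -/

import Mathlib

namespace ConformalRigidity

variable {V : Type*} [DecidableEq V]

/-- The vector `z_ab = e_a - e_b`. -/
def zVec (a b : V) : V → ℝ := Pi.single a 1 - Pi.single b 1

/-- The elementary Laplacian `z_ab z_abᵀ` of the unordered pair `ab`. -/
def edgeLaplacian : Sym2 V → Matrix V V ℝ :=
  Sym2.lift ⟨fun a b => Matrix.vecMulVec (zVec a b) (zVec a b), fun a b => by
    have h : zVec b a = -zVec a b := by simp [zVec]
    show Matrix.vecMulVec (zVec a b) (zVec a b) = Matrix.vecMulVec (zVec b a) (zVec b a)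
    rw [h, Matrix.vecMulVec_neg, Matrix.neg_vecMulVec, neg_neg]⟩

theorem edgeLaplacian_isHermitian (e : Sym2 V) : (edgeLaplacian e).IsHermitian := by
  induction e using Sym2.ind with
  | h a b =>
    ext i j
    simp [edgeLaplacian, Matrix.vecMulVec_apply, mul_comm]

variable [Fintype V] (G : SimpleGraph V) [DecidableRel G.Adj]

/-- The weighted Laplacian `∑_{ab ∈ E} w_ab z_ab z_abᵀ`. -/
def weightedLaplacian (w : G.edgeSet → ℝ) : Matrix V V ℝ :=
  ∑ e : G.edgeSet, w e • edgeLaplacian (e : Sym2 V)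

theorem weightedLaplacian_isHermitian (w : G.edgeSet → ℝ) :
    (weightedLaplacian G w).IsHermitian := by
  unfold weightedLaplacian
  rw [Matrix.IsHermitian, Matrix.conjTranspose_sum]
  refine Finset.sum_congr rfl fun e _ => ?_
  rw [Matrix.conjTranspose_smul, (edgeLaplacian_isHermitian (e : Sym2 V)).eq, star_trivial]

/-- The simplex of edge weights: `w ≥ 0` with total weight `|E|`. -/
def weightSimplex : Set (G.edgeSet → ℝ) :=
  {w | (∀ e, 0 ≤ w e) ∧ ∑ e, w e = (Fintype.card G.edgeSet : ℝ)}

/-- The eigenvalues of the weighted Laplacian with multiplicity, in increasing order. Indices start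
at `0`, so `eigenvalue G w i` is `λ_{i+1}(w)`. (Mathlib's `eigenvalues₀` is decreasing.) -/
noncomputable def eigenvalue (w : G.edgeSet → ℝ) (i : Fin (Fintype.card V)) : ℝ :=
  (weightedLaplacian_isHermitian G w).eigenvalues₀ i.rev

/-- `S_k(w) = λ_{n-k+1}(w) + ⋯ + λ_n(w)`, the sum of the `k` largest nontrivial eigenvalues
(for `1 ≤ k ≤ n - 1`). -/
noncomputable def sumLargest (k : ℕ) (w : G.edgeSet → ℝ) : ℝ :=
  ∑ i : Fin (Fintype.card V) with Fintype.card V ≤ i.val + k, eigenvalue G w i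

/-- `s_k(w) = λ_2(w) + ⋯ + λ_{k+1}(w)`, the sum of the `k` smallest nontrivial eigenvalues
(for `1 ≤ k ≤ n - 1`). -/
noncomputable def sumSmallest (k : ℕ) (w : G.edgeSet → ℝ) : ℝ :=
  ∑ i : Fin (Fintype.card V) with 1 ≤ i.val ∧ i.val ≤ k, eigenvalue G w i

/-- `G` is `k`-conformally rigid: `s_k(w) ≤ s_k(𝟙) ≤ S_k(𝟙) ≤ S_k(w')` for all admissible
weights `w`, `w'`. -/
def IsConformallyRigid (k : ℕ) : Prop :=
  ∀ w ∈ weightSimplex G, ∀ w' ∈ weightSimplex G,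
    sumSmallest G k w ≤ sumSmallest G k 1 ∧
    sumSmallest G k 1 ≤ sumLargest G k 1 ∧
    sumLargest G k 1 ≤ sumLargest G k w'

/-- `G` is `k`-conformally rigid for every `k ∈ {1, …, n - 1}`. -/
def IsTotallyConformallyRigid : Prop :=
  ∀ k : ℕ, 1 ≤ k → k < Fintype.card V → IsConformallyRigid G k

open Classical in
/-- The spanning trees of `G`, as sets `T` of edges of `G` such that the graph `(V, T)` is a
tree. -/
noncomputable def spanningTrees : Finset (Finset G.edgeSet) :=
  {T | (SimpleGraph.fromEdgeSet (Subtype.val '' (T : Set G.edgeSet))).IsTree}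

/-- The weighted spanning-tree count `τ(G, w) = ∑_T ∏_{e ∈ T} w_e`. -/
noncomputable def treeCount (w : G.edgeSet → ℝ) : ℝ :=
  ∑ T ∈ spanningTrees G, ∏ e ∈ T, w e

end ConformalRigidity

/-! The nontrivial eigenvalues turn the tree count into a product: n·τ(w) = λ_2(w)⋯λ_n(w). The
inequalities s_k(w) ≤ s_k(𝟙) bound the partial sums of the increasing sequence λ_2(w), …, λ_n(w) by
those of λ_2(𝟙), …, λ_n(𝟙). Such a domination passes to products: Abel summation against the
decreasing weights 1/λ_i(𝟙) gives ∑ (λ_i(w)/λ_i(𝟙) - 1) ≤ 0, and t ≤ exp(t - 1) then bounds the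
product of the ratios by 1 (`prod_le_prod_of_weak_majorization`).

The product formula compares two values of tr adj L(w): the sum of the (n-1)-fold eigenvalue
products, and n·τ(w) by the matrix-tree theorem, which rests on Cauchy–Binet. -/

/-! ### Determinants and adjugates -/

open Matrix in
/-- A form of the **Cauchy–Binet formula** for weighted sums of rank-one matrices. -/
theorem Matrix.det_sum_smul_vecMulVec {m n R : Type*} [Fintype m] [DecidableEq m] [Fintype n]
    [DecidableEq n] [CommRing R] (a : m → n → R) (w : m → R) :
    (∑ k, w k • vecMulVec (a k) (a k)).det =
      ∑ S ∈ Finset.powersetCard (Fintype.card n) Finset.univ,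
        (∏ k ∈ S, w k) * (∑ k ∈ S, vecMulVec (a k) (a k)).det := by
  -- Multilinear expansion along rows yields a sum over maps f from rows to summands; grouping
  -- injective f by image gives a coefficient independent of w.
  let c : Finset m → R := fun S =>
    ∑ f : n → m with Function.Injective f ∧ Finset.univ.image f = S,
      (∏ i, a (f i) i) * (Matrix.of fun i => a (f i)).det
  have key : ∀ w : m → R, (∑ k, w k • vecMulVec (a k) (a k)).det =
      ∑ S ∈ Finset.powersetCard (Fintype.card n) Finset.univ, (∏ k ∈ S, w k) * c S := by
    intro w
    have hrow : (∑ k, w k • vecMulVec (a k) (a k)) =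
        fun i => ∑ k, (w k * a k i) • a k := by
      ext i j
      simp [Matrix.sum_apply, vecMulVec_apply, mul_assoc]
    have hexp : (∑ k, w k • vecMulVec (a k) (a k)).det =
        ∑ f : n → m, (∏ i, w (f i) * a (f i) i) * (Matrix.of fun i => a (f i)).det := by
      rw [hrow]
      change (detRowAlternating (R := R) (n := n)).toMultilinearMap _ = _
      rw [MultilinearMap.map_sum]
      refine Finset.sum_congr rfl fun f _ => ?_
      rw [MultilinearMap.map_smul_univ]
      rfl
    rw [hexp, ← Finset.sum_filter_of_ne (p := Function.Injective)]
    · rw [← Finset.sum_fiberwise_of_maps_to (g := fun f : n → m => Finset.univ.image f)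
        (t := Finset.powersetCard (Fintype.card n) Finset.univ)]
      · refine Finset.sum_congr rfl fun S _ => ?_
        rw [Finset.filter_filter, Finset.mul_sum]
        refine Finset.sum_congr rfl fun f hf => ?_
        obtain ⟨hinj, rfl⟩ := (Finset.mem_filter.1 hf).2
        rw [Finset.prod_image (fun i _ j _ h => hinj h), Finset.prod_mul_distrib, mul_assoc]
      · intro f hf
        rw [Finset.mem_powersetCard]
        exact ⟨Finset.subset_univ _,
          by rw [Finset.card_image_of_injective _ (Finset.mem_filter.1 hf).2, Finset.card_univ]⟩
    · intro f _ hne i j hij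
      by_contra h
      exact hne (by rw [Matrix.det_zero_of_row_eq h (congrArg a hij), mul_zero])
  have hc : ∀ S ∈ Finset.powersetCard (Fintype.card n) (Finset.univ : Finset m),
      c S = (∑ k ∈ S, vecMulVec (a k) (a k)).det := by
    intro S hS
    -- Evaluating at the indicator weight of S isolates `c S`: any other set of the same size leaves
    -- S, so its product vanishes.
    have h := key fun k => if k ∈ S then 1 else 0
    simp only [ite_smul, one_smul, zero_smul] at h
    rw [Finset.sum_ite_mem, Finset.univ_inter] at h
    rw [h, Finset.sum_eq_single_of_mem S hS]
    · rw [Finset.prod_congr rfl fun k hk => if_pos hk, Finset.prod_const_one, one_mul]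
    · intro S' hS' hne
      have : ∃ k ∈ S', k ∉ S := by
        by_contra! hsub
        exact hne (Finset.eq_of_subset_of_card_le hsub
          (by rw [(Finset.mem_powersetCard.1 hS).2, (Finset.mem_powersetCard.1 hS').2]))
      obtain ⟨k, hk, hkS⟩ := this
      rw [Finset.prod_eq_zero hk (if_neg hkS), zero_mul]
  rw [key w]
  exact Finset.sum_congr rfl fun S hS => by rw [hc S hS]

/-- The adjugate reverses products and the trace is cyclic, so diagonalizing works even for singular
A. -/
theorem Matrix.trace_adjugate_eq_sum_prod_eigenvalues {n : Type*} [Fintype n] [DecidableEq n]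
    {A : Matrix n n ℝ} (hA : A.IsHermitian) :
    A.adjugate.trace = ∑ i, ∏ j ∈ Finset.univ.erase i, hA.eigenvalues j := by
  have hU : star (hA.eigenvectorUnitary : Matrix n n ℝ) * hA.eigenvectorUnitary = 1 :=
    Unitary.coe_star_mul_self hA.eigenvectorUnitary
  have hsp := hA.spectral_theorem
  rw [Unitary.conjStarAlgAut_apply] at hsp
  conv_lhs => rw [hsp]
  rw [Matrix.adjugate_mul_distrib, Matrix.adjugate_mul_distrib, Matrix.trace_mul_comm,
    Matrix.mul_assoc, ← Matrix.adjugate_mul_distrib]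
  rw [hU, Matrix.adjugate_one, Matrix.mul_one, Matrix.adjugate_diagonal, Matrix.trace_diagonal]
  rfl

theorem Matrix.trace_adjugate_eq_sum_prod_eigenvalues₀ {n : Type*} [Fintype n] [DecidableEq n]
    {A : Matrix n n ℝ} (hA : A.IsHermitian) :
    A.adjugate.trace = ∑ i, ∏ j ∈ Finset.univ.erase i, hA.eigenvalues₀ j := by
  rw [Matrix.trace_adjugate_eq_sum_prod_eigenvalues hA]
  let e : Fin (Fintype.card n) ≃ n := Fintype.equivOfCardEq (Fintype.card_fin _)
  refine Fintype.sum_equiv e.symm _ _ fun i => ?_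
  refine Finset.prod_bij (fun j _ => e.symm j) ?_ ?_ ?_ ?_
  · intro j hj; simpa using hj
  · intro j _ k _ h; simpa using h
  · intro j hj; exact ⟨e j, by simpa [Equiv.eq_symm_apply] using hj, by simp⟩
  · intro j _; rfl

theorem Matrix.adjugate_apply_self {n R : Type*} [Fintype n] [DecidableEq n] [CommRing R]
    (A : Matrix n n R) (hA : A.det = 0) (r : n) :
    A.adjugate r r =
      (A + Matrix.vecMulVec (Pi.single r 1) (Pi.single r 1)).det := by
  have h : A + Matrix.vecMulVec (Pi.single r 1) (Pi.single r 1) =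
      A.updateRow r (A r + Pi.single r 1) := by
    ext i j
    by_cases hi : i = r
    · subst hi; simp [Matrix.vecMulVec_apply]
    · simp [Matrix.vecMulVec_apply, hi]
  rw [h, Matrix.det_updateRow_add, Matrix.updateRow_eq_self, hA, zero_add, Matrix.adjugate_apply]

/-! ### Partial sums and products -/

/-- Abel summation as an induction: replacing c k by the smaller c (k + 1) can only raise its
product with a nonpositive partial sum. -/
theorem sum_mul_le_of_antitone (c d : ℕ → ℝ) (N : ℕ)
    (hc : ∀ i j, i ≤ j → j < N → c j ≤ c i)
    (hd : ∀ k ≤ N, ∑ i ∈ Finset.range k, d i ≤ 0) (k : ℕ) (hk : k < N) :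
    ∑ i ∈ Finset.range (k + 1), c i * d i ≤ c k * ∑ i ∈ Finset.range (k + 1), d i := by
  induction k with
  | zero => simp
  | succ k ih =>
    rw [Finset.sum_range_succ, Finset.sum_range_succ _ (k + 1), mul_add]
    have h1 := ih (by omega)
    have h2 := mul_le_mul_of_nonpos_right (hc k (k + 1) (by omega) hk) (hd (k + 1) (by omega))
    linarith

theorem prod_le_prod_of_weak_majorization (x y : ℕ → ℝ) (N : ℕ)
    (hx : ∀ i < N, 0 ≤ x i) (hy : ∀ i < N, 0 < y i)
    (hmono : ∀ i j, i ≤ j → j < N → y i ≤ y j)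
    (hsum : ∀ k ≤ N, ∑ i ∈ Finset.range k, x i ≤ ∑ i ∈ Finset.range k, y i) :
    ∏ i ∈ Finset.range N, x i ≤ ∏ i ∈ Finset.range N, y i := by
  rcases N with _ | N
  · simp
  have hratio : ∑ i ∈ Finset.range (N + 1), (x i / y i - 1) ≤ 0 := by
    have hd : ∀ k ≤ N + 1, ∑ i ∈ Finset.range k, (x i - y i) ≤ 0 := fun k hk => by
      rw [Finset.sum_sub_distrib]; linarith [hsum k hk]
    have h := sum_mul_le_of_antitone (fun i => (y i)⁻¹) (fun i => x i - y i) (N + 1)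
      (fun i j hij hj => inv_anti₀ (hy i (by omega)) (hmono i j hij hj)) hd N (by omega)
    have h2 : (y N)⁻¹ * ∑ i ∈ Finset.range (N + 1), (x i - y i) ≤ 0 :=
      mul_nonpos_of_nonneg_of_nonpos (inv_nonneg.2 (hy N (by omega)).le) (hd _ le_rfl)
    refine (le_of_eq ?_).trans (h.trans h2)
    refine Finset.sum_congr rfl fun i hi => ?_
    have := (hy i (Finset.mem_range.1 hi)).ne'
    field_simp
  have hprod : ∏ i ∈ Finset.range (N + 1), x i / y i ≤ 1 := by
    calc ∏ i ∈ Finset.range (N + 1), x i / y i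
        ≤ ∏ i ∈ Finset.range (N + 1), Real.exp (x i / y i - 1) := by
          refine Finset.prod_le_prod (fun i hi => ?_) fun i _ => ?_
          · exact div_nonneg (hx i (Finset.mem_range.1 hi)) (hy i (Finset.mem_range.1 hi)).le
          · linarith [Real.add_one_le_exp (x i / y i - 1)]
      _ = Real.exp (∑ i ∈ Finset.range (N + 1), (x i / y i - 1)) := (Real.exp_sum _ _).symm
      _ ≤ 1 := Real.exp_le_one_iff.2 hratio
  rw [Finset.prod_div_distrib] at hprod
  exact (div_le_one (Finset.prod_pos fun i hi => hy i (Finset.mem_range.1 hi))).1 hprod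

namespace ConformalRigidity

/-! ### The weighted matrix-tree theorem -/

section MatrixTree

variable {V : Type*} [Fintype V] [DecidableEq V]

/-- The signed incidence vector of an arbitrarily oriented edge. -/
noncomputable def incidenceVec (e : Sym2 V) : V → ℤ :=
  Pi.single e.out.1 1 - Pi.single e.out.2 1

omit [Fintype V] in
theorem edgeLaplacian_eq_vecMulVec (e : Sym2 V) :
    edgeLaplacian e =
      Matrix.vecMulVec (fun i => (incidenceVec e i : ℝ)) (fun i => (incidenceVec e i : ℝ)) := by
  have h : e = s(e.out.1, e.out.2) := (Quot.out_eq e).symm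
  have hz : (fun i => (incidenceVec e i : ℝ)) = zVec e.out.1 e.out.2 := by
    ext i
    simp [incidenceVec, zVec, Pi.single_apply]
  rw [hz]
  conv_lhs => rw [h]
  rfl

variable (G : SimpleGraph V) [DecidableRel G.Adj]

/-- The signed incidence vectors of the edges, together with the indicator vector of a root. -/
noncomputable def rootedIncidenceVec (r : V) : Option G.edgeSet → V → ℤ
  | none => Pi.single r 1
  | some e => incidenceVec (e : Sym2 V)

/-- The spanning subgraph with edge set `T`. -/
abbrev spanningSubgraph (T : Finset G.edgeSet) : SimpleGraph V :=
  SimpleGraph.fromEdgeSet (Subtype.val '' (T : Set G.edgeSet))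

omit [Fintype V] [DecidableEq V] [DecidableRel G.Adj] in
theorem edgeSet_spanningSubgraph (T : Finset G.edgeSet) :
    (spanningSubgraph G T).edgeSet = Subtype.val '' (T : Set G.edgeSet) := by
  rw [SimpleGraph.edgeSet_fromEdgeSet, sdiff_eq_left, Set.disjoint_left]
  rintro _ ⟨e, _, rfl⟩
  exact G.not_isDiag_of_mem_edgeSet e.2

omit [DecidableEq V] in
theorem mem_spanningTrees (T : Finset G.edgeSet) :
    T ∈ spanningTrees G ↔ (spanningSubgraph G T).IsTree := by
  simp [spanningTrees]

omit [DecidableEq V] [DecidableRel G.Adj] in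
theorem isTree_spanningSubgraph_iff (T : Finset G.edgeSet) :
    (spanningSubgraph G T).IsTree ↔
      (spanningSubgraph G T).Connected ∧ T.card + 1 = Fintype.card V := by
  rw [SimpleGraph.isTree_iff_connected_and_card, edgeSet_spanningSubgraph,
    Nat.card_image_of_injective Subtype.val_injective]
  simp

omit [Fintype V] [DecidableEq V] [DecidableRel G.Adj] in
theorem adj_spanningSubgraph_out {T : Finset G.edgeSet} {e : G.edgeSet} (he : e ∈ T) :
    (spanningSubgraph G T).Adj (e : Sym2 V).out.1 (e : Sym2 V).out.2 := by
  rw [← SimpleGraph.mem_edgeSet, edgeSet_spanningSubgraph]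
  exact ⟨e, he, (Quot.out_eq (e : Sym2 V)).symm⟩

/-- The Gram determinant of the rooted incidence vectors with index in `S`. -/
noncomputable def gramDet (r : V) (S : Finset (Option G.edgeSet)) : ℤ :=
  (∑ k ∈ S, Matrix.vecMulVec (rootedIncidenceVec G r k) (rootedIncidenceVec G r k)).det

omit [DecidableRel G.Adj] in
theorem gramDet_eq_zero {r : V} {S : Finset (Option G.edgeSet)} (v : V → ℤ) (hv : v ≠ 0)
    (h : ∀ k ∈ S, rootedIncidenceVec G r k ⬝ᵥ v = 0) : gramDet G r S = 0 := by
  refine Matrix.exists_mulVec_eq_zero_iff.1 ⟨v, hv, ?_⟩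
  rw [Matrix.sum_mulVec]
  refine Finset.sum_eq_zero fun k hk => ?_
  rw [Matrix.vecMulVec_mulVec, h k hk]
  simp

omit [DecidableRel G.Adj] in
theorem gramDet_eq_zero_of_none_notMem {r : V} {S : Finset (Option G.edgeSet)} (hS : none ∉ S) :
    gramDet G r S = 0 := by
  refine gramDet_eq_zero G 1 (fun h => one_ne_zero (congrFun h r)) fun k hk => ?_
  rcases k with _ | e
  · exact absurd hk hS
  · simp [rootedIncidenceVec, incidenceVec, sub_dotProduct]

omit [DecidableRel G.Adj] in
-- The indicator of the vertices unreachable from r is orthogonal to the root vector and to every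
-- edge vector of T.
theorem gramDet_eq_zero_of_not_connected {r : V} {T : Finset G.edgeSet}
    (hT : ¬ (spanningSubgraph G T).Connected) : gramDet G r (Finset.insertNone T) = 0 := by
  classical
  have hex : ∃ u, ¬ (spanningSubgraph G T).Reachable r u := by
    by_contra! h
    exact hT (SimpleGraph.connected_iff_exists_forall_reachable _ |>.2 ⟨r, h⟩)
  obtain ⟨u, hu⟩ := hex
  refine gramDet_eq_zero G
    (fun v => if (spanningSubgraph G T).Reachable r v then 0 else 1) ?_ fun k hk => ?_
  · intro h
    simpa [hu] using congrFun h u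
  · rcases k with _ | e
    · simp [rootedIncidenceVec]
    · have hadj := adj_spanningSubgraph_out G (Finset.some_mem_insertNone.1 hk)
      have hiff : (spanningSubgraph G T).Reachable r (e : Sym2 V).out.1 ↔
          (spanningSubgraph G T).Reachable r (e : Sym2 V).out.2 :=
        ⟨fun h => h.trans hadj.reachable, fun h => h.trans hadj.symm.reachable⟩
      simp [rootedIncidenceVec, incidenceVec, sub_dotProduct, hiff]

omit [DecidableRel G.Adj] in
-- The integer row span contains e_r, and along walks in the tree every e_v. The square matrix is
-- thus invertible over ℤ, with determinant ±1 and Gram determinant 1.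
theorem gramDet_eq_one_of_isTree {r : V} {T : Finset G.edgeSet}
    (hT : (spanningSubgraph G T).IsTree) : gramDet G r (Finset.insertNone T) = 1 := by
  obtain ⟨hconn, hcard⟩ := (isTree_spanningSubgraph_iff G T).1 hT
  obtain ⟨g⟩ : Nonempty (V ≃ Finset.insertNone T) :=
    Fintype.card_eq.1 (by rw [Fintype.card_coe, Finset.card_insertNone, hcard])
  let M : Matrix V V ℤ := Matrix.of fun i => rootedIncidenceVec G r (g i)
  have hM : ∑ k ∈ Finset.insertNone T,
      Matrix.vecMulVec (rootedIncidenceVec G r k) (rootedIncidenceVec G r k) = M.transpose * M := by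
    ext i j
    rw [Matrix.sum_apply, Matrix.mul_apply, ← Finset.sum_coe_sort]
    exact (Fintype.sum_equiv g _ _ fun k => rfl).symm
  have hrow : ∀ k ∈ Finset.insertNone T,
      rootedIncidenceVec G r k ∈ LinearMap.range M.vecMulLinear := by
    intro k hk
    refine ⟨Pi.single (g.symm ⟨k, hk⟩) 1, ?_⟩
    ext j
    simp [M]
  have hspan : ∀ v, (spanningSubgraph G T).Reachable r v →
      (Pi.single v 1 : V → ℤ) ∈ LinearMap.range M.vecMulLinear := by
    have hadj : ∀ a b, (spanningSubgraph G T).Adj a b →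
        (Pi.single a 1 - Pi.single b 1 : V → ℤ) ∈ LinearMap.range M.vecMulLinear := by
      intro a b hab
      have hmem : s(a, b) ∈ (spanningSubgraph G T).edgeSet := hab
      rw [edgeSet_spanningSubgraph] at hmem
      obtain ⟨e, he, hab'⟩ := hmem
      have h := hrow (some e) (Finset.some_mem_insertNone.2 he)
      have hout : s((e : Sym2 V).out.1, (e : Sym2 V).out.2) = s(a, b) :=
        (Quot.out_eq (e : Sym2 V)).trans hab'
      rcases Sym2.eq_iff.1 hout with ⟨h1, h2⟩ | ⟨h1, h2⟩
      · simpa [rootedIncidenceVec, incidenceVec, h1, h2] using h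
      · simpa [rootedIncidenceVec, incidenceVec, h1, h2] using Submodule.neg_mem _ h
    have hwalk : ∀ a b, (spanningSubgraph G T).Walk a b →
        (Pi.single a 1 : V → ℤ) ∈ LinearMap.range M.vecMulLinear →
        (Pi.single b 1 : V → ℤ) ∈ LinearMap.range M.vecMulLinear := by
      intro a b p
      induction p with
      | nil => exact id
      | cons h p ih =>
        intro ha
        refine ih ?_
        simpa using Submodule.sub_mem _ ha (hadj _ _ h)
    rintro v ⟨p⟩
    exact hwalk r v p (hrow none Finset.none_mem_insertNone)
  have hunit : IsUnit M := by
    rw [← Matrix.vecMul_surjective_iff_isUnit]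
    change Function.Surjective M.vecMulLinear
    rw [← LinearMap.range_eq_top, eq_top_iff]
    intro v _
    rw [pi_eq_sum_univ' v]
    refine Submodule.sum_mem _ fun i _ => Submodule.smul_mem _ _ ?_
    have := hspan i (hconn.preconnected r i)
    convert this using 1
  have hdet : IsUnit M.det := (Matrix.isUnit_iff_isUnit_det M).1 hunit
  rw [gramDet, hM, Matrix.det_mul, Matrix.det_transpose]
  exact Int.isUnit_mul_self hdet

theorem weightedLaplacian_mulVec_one (w : G.edgeSet → ℝ) :
    (weightedLaplacian G w).mulVec 1 = 0 := by
  rw [weightedLaplacian, Matrix.sum_mulVec]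
  refine Finset.sum_eq_zero fun e _ => ?_
  rw [Matrix.smul_mulVec, edgeLaplacian_eq_vecMulVec, Matrix.vecMulVec_mulVec]
  simp [dotProduct, incidenceVec, Pi.single_apply]

theorem det_weightedLaplacian [Nonempty V] (w : G.edgeSet → ℝ) :
    (weightedLaplacian G w).det = 0 :=
  Matrix.exists_mulVec_eq_zero_iff.1 ⟨1, one_ne_zero, weightedLaplacian_mulVec_one G w⟩

/-- The weighted **matrix-tree theorem**. -/
theorem adjugate_weightedLaplacian_apply_self (w : G.edgeSet → ℝ) (r : V) :
    (weightedLaplacian G w).adjugate r r = treeCount G w := by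
  have : Nonempty V := ⟨r⟩
  rw [Matrix.adjugate_apply_self _ (det_weightedLaplacian G w)]
  -- The rank-one correction at r acts as one extra index `none` of weight 1.
  have hsum : weightedLaplacian G w + Matrix.vecMulVec (Pi.single r 1) (Pi.single r 1) =
      ∑ k : Option G.edgeSet, k.elim 1 w •
        Matrix.vecMulVec (fun i => (rootedIncidenceVec G r k i : ℝ))
          (fun i => (rootedIncidenceVec G r k i : ℝ)) := by
    rw [Fintype.sum_option, add_comm, weightedLaplacian]
    congr 1
    · have : (fun i => (rootedIncidenceVec G r none i : ℝ)) = Pi.single r 1 := by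
        ext i
        simp [rootedIncidenceVec, Pi.single_apply]
      rw [this]
      simp
    · exact Finset.sum_congr rfl fun e _ => by
        rw [edgeLaplacian_eq_vecMulVec]; rfl
  have hgram : ∀ S : Finset (Option G.edgeSet),
      (∑ k ∈ S, Matrix.vecMulVec (fun i => (rootedIncidenceVec G r k i : ℝ))
          (fun i => (rootedIncidenceVec G r k i : ℝ))).det = (gramDet G r S : ℝ) := by
    intro S
    rw [gramDet, Int.cast_det]
    congr 1
    ext i j
    simp [Matrix.sum_apply, Matrix.vecMulVec_apply]
  rw [hsum, Matrix.det_sum_smul_vecMulVec]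
  simp only [hgram]
  have hsub : (spanningTrees G).map Finset.insertNone.toEmbedding ⊆
      Finset.powersetCard (Fintype.card V) Finset.univ := by
    intro S hS
    obtain ⟨T, hT, rfl⟩ := Finset.mem_map.1 hS
    rw [mem_spanningTrees] at hT
    rw [Finset.mem_powersetCard]
    exact ⟨Finset.subset_univ _,
      (Finset.card_insertNone T).trans ((isTree_spanningSubgraph_iff G T).1 hT).2⟩
  rw [← Finset.sum_subset hsub, Finset.sum_map, treeCount]
  · refine Finset.sum_congr rfl fun T hT => ?_
    rw [mem_spanningTrees] at hT
    change (∏ k ∈ Finset.insertNone T, _) * (gramDet G r (Finset.insertNone T) : ℝ) = _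
    rw [gramDet_eq_one_of_isTree G hT, Finset.prod_insertNone]
    simp
  · intro S hS hS'
    by_cases hnone : none ∈ S
    · obtain ⟨T, rfl⟩ : ∃ T : Finset G.edgeSet, S = Finset.insertNone T :=
        ⟨Finset.eraseNone S, by rw [Finset.insertNone_eraseNone, Finset.insert_eq_of_mem hnone]⟩
      have hT : ¬ (spanningSubgraph G T).Connected := by
        intro hconn
        refine hS' (Finset.mem_map.2 ⟨T, ?_, rfl⟩)
        rw [mem_spanningTrees]
        refine (isTree_spanningSubgraph_iff G T).2 ⟨hconn, ?_⟩
        rw [← Finset.card_insertNone]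
        exact (Finset.mem_powersetCard.1 hS).2
      rw [gramDet_eq_zero_of_not_connected G hT, Int.cast_zero, mul_zero]
    · rw [gramDet_eq_zero_of_none_notMem G hnone, Int.cast_zero, mul_zero]

omit [DecidableEq V] in
theorem treeCount_one_pos (hconn : G.Connected) : 0 < treeCount G 1 := by
  obtain ⟨H, hle, hH⟩ := hconn.exists_isTree_le
  classical
  let T : Finset G.edgeSet := {e | (e : Sym2 V) ∈ H.edgeSet}
  have hT : Subtype.val '' (T : Set G.edgeSet) = H.edgeSet := by
    ext e
    simp only [T, Finset.coe_filter, Finset.mem_univ, true_and, Set.mem_image, Set.mem_ofPred_eq]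
    exact ⟨by rintro ⟨e, he, rfl⟩; exact he,
      fun he => ⟨⟨e, SimpleGraph.edgeSet_mono hle he⟩, he, rfl⟩⟩
  have hmem : T ∈ spanningTrees G := by
    rw [mem_spanningTrees, spanningSubgraph, hT, SimpleGraph.fromEdgeSet_edgeSet]
    exact hH
  simp only [treeCount, Pi.one_apply, Finset.prod_const_one, Finset.sum_const, nsmul_eq_mul,
    mul_one, Nat.cast_pos]
  exact Finset.card_pos.2 ⟨T, hmem⟩

end MatrixTree

end ConformalRigidity

namespace ConformalRigidity

/-! ### Spectrum of the weighted Laplacian -/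

section Spectrum

variable {V : Type*} [Fintype V] [DecidableEq V] (G : SimpleGraph V) [DecidableRel G.Adj]

theorem posSemidef_weightedLaplacian {w : G.edgeSet → ℝ} (hw : ∀ e, 0 ≤ w e) :
    (weightedLaplacian G w).PosSemidef := by
  refine Matrix.posSemidef_sum _ fun e _ => Matrix.PosSemidef.smul ?_ (hw e)
  rw [edgeLaplacian_eq_vecMulVec]
  simpa using Matrix.posSemidef_vecMulVec_self_star
    (fun i => (incidenceVec (e : Sym2 V) i : ℝ))

theorem eigenvalue_monotone (w : G.edgeSet → ℝ) : Monotone (eigenvalue G w) := fun _ _ hij =>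
  (weightedLaplacian_isHermitian G w).eigenvalues₀_antitone (Fin.rev_le_rev.2 hij)

theorem eigenvalue_nonneg {w : G.edgeSet → ℝ} (hw : ∀ e, 0 ≤ w e) (i : Fin (Fintype.card V)) :
    0 ≤ eigenvalue G w i := by
  have h := (posSemidef_weightedLaplacian G hw).eigenvalues_nonneg
    (Fintype.equivOfCardEq (Fintype.card_fin _) i.rev)
  simpa [eigenvalue, Matrix.IsHermitian.eigenvalues] using h

theorem prod_eigenvalue [Nonempty V] (w : G.edgeSet → ℝ) : ∏ i, eigenvalue G w i = 0 := by
  have h := (weightedLaplacian_isHermitian G w).det_eq_prod_eigenvalues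
  rw [det_weightedLaplacian] at h
  rw [h]
  refine Fintype.prod_equiv (Fin.revPerm.trans (Fintype.equivOfCardEq (Fintype.card_fin _))) _ _
    fun i => ?_
  simp [eigenvalue, Matrix.IsHermitian.eigenvalues]

theorem sum_prod_erase_eigenvalue (w : G.edgeSet → ℝ) :
    ∑ i, ∏ j ∈ Finset.univ.erase i, eigenvalue G w j = Fintype.card V * treeCount G w := by
  have h := Matrix.trace_adjugate_eq_sum_prod_eigenvalues₀ (weightedLaplacian_isHermitian G w)
  simp only [Matrix.trace, Matrix.diag, adjugate_weightedLaplacian_apply_self, Finset.sum_const,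
    Finset.card_univ, nsmul_eq_mul] at h
  rw [h]
  refine Fintype.sum_equiv Fin.revPerm _ _ fun i => ?_
  refine Finset.prod_bij (fun j _ => j.rev) (fun j hj => by simpa using hj)
    (fun j _ k _ h => by simpa using h)
    (fun j hj => ⟨j.rev, by simpa [Fin.rev_eq_iff] using hj, by simp⟩) fun j _ => rfl

/-- The `j`-th nontrivial eigenvalue in increasing order, starting at `0`. -/
noncomputable def nontrivialEigenvalue (w : G.edgeSet → ℝ) (j : ℕ) : ℝ :=
  if h : j + 1 < Fintype.card V then eigenvalue G w ⟨j + 1, h⟩ else 0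

/-- The index j stands for λ_{j+2}; `hk` keeps the range clear of the default value 0. -/
theorem sumSmallest_eq_sum_range (w : G.edgeSet → ℝ) {k : ℕ} (hk : k < Fintype.card V) :
    sumSmallest G k w = ∑ j ∈ Finset.range k, nontrivialEigenvalue G w j := by
  symm
  refine Finset.sum_bij
    (fun j hj => ⟨j + 1, by have := Finset.mem_range.1 hj; omega⟩) ?_ ?_ ?_ ?_
  · intro j hj
    have := Finset.mem_range.1 hj
    simp only [Finset.mem_filter, Finset.mem_univ, true_and]
    omega
  · intro i _ j _ h
    simpa using h
  · intro i hi
    obtain ⟨h1, h2⟩ := (Finset.mem_filter.1 hi).2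
    exact ⟨i - 1, Finset.mem_range.2 (by omega), Fin.ext (by simp; omega)⟩
  · intro j hj
    have := Finset.mem_range.1 hj
    exact dif_pos (by omega)

theorem prod_nontrivialEigenvalue [Nonempty V] {w : G.edgeSet → ℝ} (hw : ∀ e, 0 ≤ w e) :
    ∏ j ∈ Finset.range (Fintype.card V - 1), nontrivialEigenvalue G w j =
      Fintype.card V * treeCount G w := by
  have hn : 0 < Fintype.card V := Fintype.card_pos
  -- Some eigenvalue vanishes and none is negative, so the least is 0. Only the product omitting it
  -- survives in the sum below.
  have hzero : eigenvalue G w ⟨0, hn⟩ = 0 := by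
    obtain ⟨i, _, hi⟩ := Finset.prod_eq_zero_iff.1 (prod_eigenvalue G w)
    exact le_antisymm (hi ▸ eigenvalue_monotone G w (Fin.mk_le_of_le_val (Nat.zero_le _)))
      (eigenvalue_nonneg G hw _)
  rw [← sum_prod_erase_eigenvalue, Finset.sum_eq_single_of_mem ⟨0, hn⟩ (Finset.mem_univ _)]
  · refine Finset.prod_bij
      (fun j hj => ⟨j + 1, by have := Finset.mem_range.1 hj; omega⟩) ?_ ?_ ?_ ?_
    · intro j hj
      simp
    · intro i _ j _ h
      simpa using h
    · intro i hi
      have : i.val ≠ 0 := fun h => Finset.ne_of_mem_erase hi (Fin.ext h)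
      exact ⟨i - 1, Finset.mem_range.2 (by omega), Fin.ext (by simp; omega)⟩
    · intro j hj
      have := Finset.mem_range.1 hj
      exact dif_pos (by omega)
  · intro i _ hi
    exact Finset.prod_eq_zero (Finset.mem_erase.2 ⟨hi.symm, Finset.mem_univ _⟩) hzero

theorem nontrivialEigenvalue_nonneg {w : G.edgeSet → ℝ} (hw : ∀ e, 0 ≤ w e) (j : ℕ) :
    0 ≤ nontrivialEigenvalue G w j := by
  unfold nontrivialEigenvalue
  split_ifs
  · exact eigenvalue_nonneg G hw _
  · exact le_rfl

theorem nontrivialEigenvalue_le (w : G.edgeSet → ℝ) {i j : ℕ} (hij : i ≤ j)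
    (hj : j < Fintype.card V - 1) : nontrivialEigenvalue G w i ≤ nontrivialEigenvalue G w j := by
  unfold nontrivialEigenvalue
  rw [dif_pos (by omega), dif_pos (by omega)]
  exact eigenvalue_monotone G w (Fin.mk_le_mk.2 (by omega))

omit [DecidableEq V] in
theorem one_mem_weightSimplex : (1 : G.edgeSet → ℝ) ∈ weightSimplex G :=
  ⟨fun _ => zero_le_one, by simp⟩

end Spectrum

end ConformalRigidity

/-! ### Maximality of the tree count -/

theorem mainTheorem7 {V : Type*} [Fintype V] [DecidableEq V]
    (G : SimpleGraph V) [DecidableRel G.Adj]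
    (hconn : G.Connected) (hedge : G.edgeSet.Nonempty)
    (hG : ConformalRigidity.IsTotallyConformallyRigid G) :
    (1 : G.edgeSet → ℝ) ∈ ConformalRigidity.weightSimplex G ∧
    ∀ w ∈ ConformalRigidity.weightSimplex G,
      ConformalRigidity.treeCount G w ≤ ConformalRigidity.treeCount G 1 := by
  open ConformalRigidity in
  refine ⟨one_mem_weightSimplex G, fun w hw => ?_⟩
  have : Nonempty V := hconn.nonempty
  have hn : (0 : ℝ) < Fintype.card V := Nat.cast_pos.2 Fintype.card_pos
  have hone := one_mem_weightSimplex G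
  refine le_of_mul_le_mul_left ?_ hn
  rw [← prod_nontrivialEigenvalue G hw.1, ← prod_nontrivialEigenvalue G hone.1]
  -- A connected graph has a spanning tree, so no nontrivial eigenvalue at 𝟙 vanishes; this permits
  -- division by them.
  have hpos : 0 < ∏ j ∈ Finset.range (Fintype.card V - 1), nontrivialEigenvalue G 1 j := by
    rw [prod_nontrivialEigenvalue G hone.1]
    exact mul_pos hn (treeCount_one_pos G hconn)
  refine prod_le_prod_of_weak_majorization _ _ _
    (fun i _ => nontrivialEigenvalue_nonneg G hw.1 i) (fun i hi => ?_)
    (fun i j hij hj => nontrivialEigenvalue_le G 1 hij hj) fun k hk => ?_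
  · exact (nontrivialEigenvalue_nonneg G hone.1 i).lt_of_ne'
      (Finset.prod_ne_zero_iff.1 hpos.ne' i (Finset.mem_range.2 hi))
  -- Rigidity starts at k = 1; the empty sum is separate.
  · rcases k with _ | k
    · simp
    · have hcard : k + 1 < Fintype.card V := by omega
      rw [← sumSmallest_eq_sum_range G w hcard, ← sumSmallest_eq_sum_range G 1 hcard]
      exact (hG (k + 1) (by omega) hcard w hw 1 hone).1
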